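/- Let $X$ be a topological space with lattice of open sets $\mathcal O X$. A subprobability valuation on $X$ is a Scott-continuous map $\nu\colon \mathcal O X\to[0,1]$ with $\nu(\emptyset)=0$ and $\nu(U)+\nu(V)=\nu(U\cup V)+\nu(U\cap V)$ for all open $U,V$. Let $\mathcal V X$ be the set of these, ordered pointwise ($\nu_1\le\nu_2$ iff $\nu_1(U)\le\nu_2(U)$ for all $U$); it is a dcpo (directed sets are understood to be non-empty). Let $\mathcal S X\subseteq\mathcal V X$ be the set of simple valuations $\sum_{i=1}^n r_i\delta_{x_i}$ with $n\ge 0$, $x_i\in X$, $r_i>0$ and $\sum_{i=1}^n r_i\le 1$, where $\delta_x(U)=1$ if $x\in U$ and $\delta_x(U)=0$ otherwise. Let $\mathcal M X$ be the intersection of all subsets of $\mathcal V X$ that contain $\mathcal S X$ and are closed under suprema, taken in $\mathcal V X$, of directed subsets. The weak topology on $\mathcal V X$ is generated by the sets $\{\nu\in\mathcal V X : \nu(U)>r\}$ with $U\in\mathcal O X$ and $r\in[0,1]$; write $\mathcal S_w X$ and $\mathcal M_w X$ for $\mathcal S X$ and $\mathcal M X$ with the relative topologies. A d-space is a $T_0$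 space that is a dcpo in its specialization order ($x\le y$ iff $x\in\overline{\{y\}}$) and all of whose open sets are Scott open for this order. Then $\mathcal M_w X$ is a $\mathbf D$-completion of $\mathcal S_w X$. That is: $\mathcal M_w X$ is a d-space; the inclusion map $i\colon\mathcal S_w X\to\mathcal M_w X$ is continuous; and for every d-space $Y$ and every continuous map $f\colon\mathcal S_w X\to Y$ there is a unique continuous map $f'\colon\mathcal M_w X\to Y$ with $f=f'\circ i$. -/

import Mathlib

open TopologicalSpace

/-- A subprobability valuation on a topological space `X`: a strict, modular, Scott-continuous map
from the complete lattice of open sets of `X` to `[0, 1]`. -/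
@[ext]
structure SubprobVal (X : Type*) [TopologicalSpace X] where
  toFun : Opens X → unitInterval
  scottContinuous' : ScottContinuous toFun
  strict' : toFun ⊥ = 0
  modular' : ∀ U V : Opens X,
    (toFun U : ℝ) + (toFun V : ℝ) = (toFun (U ⊔ V) : ℝ) + (toFun (U ⊓ V) : ℝ)

namespace SubprobVal

variable {X : Type*} [TopologicalSpace X]

instance : CoeFun (SubprobVal X) (fun _ => Opens X → unitInterval) := ⟨SubprobVal.toFun⟩

/-- The stochastic order: pointwise comparison on open sets. -/
instance : PartialOrder (SubprobVal X) :=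
  PartialOrder.lift SubprobVal.toFun (fun _ _ h => SubprobVal.ext h)

/-- The weak topology, with the subbasic open sets `[U > r] = {ν | ν U > r}`. -/
instance : TopologicalSpace (SubprobVal X) :=
  generateFrom {s | ∃ (U : Opens X) (r : unitInterval), s = {ν : SubprobVal X | r < ν U}}

open Classical in
/-- The Dirac valuation at `x`. -/
noncomputable def dirac (x : X) : SubprobVal X where
  toFun U := if x ∈ U then 1 else 0
  scottContinuous' := by
    intro d hne _ U hU
    have hU' : U = sSup d := hU.unique (isLUB_sSup d)
    by_cases hx : x ∈ U
    · have hx' : x ∈ sSup d := hU' ▸ hx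
      obtain ⟨V, hV, hxV⟩ := Opens.mem_sSup.1 hx'
      simp only [hx, if_true]
      refine ⟨?_, fun b hb => ?_⟩
      · rintro _ ⟨W, _, rfl⟩
        exact unitInterval.le_one'
      · simpa [hxV] using hb (Set.mem_image_of_mem _ hV)
    · simp only [hx, if_false]
      refine ⟨?_, fun b _ => unitInterval.nonneg'⟩
      rintro _ ⟨W, hW, rfl⟩
      have hxW : x ∉ W := fun h => hx (hU.1 hW h)
      simp [hxW]
  strict' := by simp
  modular' U V := by
    by_cases hU : x ∈ U <;> by_cases hV : x ∈ V <;> simp [hU, hV]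

variable (X)

/-- The set `S X` of simple valuations `∑ rᵢ δ_{xᵢ}`, with finitely many `rᵢ > 0` and `∑ rᵢ ≤ 1`. -/
def simple : Set (SubprobVal X) :=
  {ν | ∃ (n : ℕ) (r : Fin n → ℝ) (x : Fin n → X),
    (∀ i, 0 < r i) ∧ ∑ i, r i ≤ 1 ∧
      ∀ U : Opens X, (ν U : ℝ) = ∑ i, r i * (dirac (x i) U : ℝ)}

/-- The set `M X`: the intersection of all sub-dcpo's of the valuations on `X`, in the stochastic
order, that contain the simple valuations. -/
def minimalVal : Set (SubprobVal X) :=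
  ⋂₀ {B : Set (SubprobVal X) | DirSupClosed B ∧ simple X ⊆ B}

theorem simple_subset_minimalVal : simple X ⊆ minimalVal X :=
  Set.subset_sInter fun _ hB => hB.2

end SubprobVal

/-- A d-space (monotone-convergence space): a `T₀` space that is a dcpo in its specialization order
(`x ≤ y` iff `x` lies in the closure of `{y}`) and all of whose open sets are Scott open in that
order. -/
structure IsDSpace (Y : Type*) [TopologicalSpace Y] : Prop where
  t0 : T0Space Y
  exists_isLUB : letI := specializationPreorder Y
    ∀ A : Set Y, A.Nonempty → DirectedOn (· ≤ ·) A → ∃ a, IsLUB A a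
  scott_open_of_isOpen : letI := specializationPreorder Y
    ∀ U : Set Y, IsOpen U → IsUpperSet U ∧ DirSupInacc U

/-! A directed supremum of valuations is pointwise, so a weakly open set contains it exactly when it
meets the directed family. Membership in open sets therefore passes from simple valuations to all of
`minimalVal X` by induction. Uniqueness follows, since two open sets with the same trace on `simple
X` agree on `minimalVal X`. For existence, extend each `f ⁻¹' V` to an open `W V`; by induction each
`ν` has a point of `Y` whose open neighbourhoods are exactly the `V` with `ν ∈ W V`, directed
suprema in `Y` supplying the limit step. -/

/-- In a space with the specialization order, `a` behaves as a topological supremum of `A` when the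
open sets that contain `a` are exactly those that meet `A`. -/
def IsNhdsSup {Y : Type*} [TopologicalSpace Y] (A : Set Y) (a : Y) : Prop :=
  ∀ V : Set Y, IsOpen V → (a ∈ V ↔ ∃ b ∈ A, b ∈ V)

theorem isDSpace_of_exists_isNhdsSup {Y : Type*} [TopologicalSpace Y] [T0Space Y]
    (h : ∀ A : Set Y, A.Nonempty → DirectedOn (fun a b => b ⤳ a) A → ∃ a, IsNhdsSup A a) :
    IsDSpace Y := by
  let _ := specializationPreorder Y
  have lub : ∀ A : Set Y, ∀ a, IsNhdsSup A a → IsLUB A a := fun A a ha =>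
    ⟨fun b hb => specializes_iff_forall_open.2 fun V hV hbV => (ha V hV).2 ⟨b, hb, hbV⟩,
      fun c hc => specializes_iff_forall_open.2 fun V hV haV =>
        let ⟨_, hb, hbV⟩ := (ha V hV).1 haV
        specializes_iff_forall_open.1 (hc hb) V hV hbV⟩
  refine ⟨inferInstance, fun A hA hd => ?_, fun U hU => ⟨?_, ?_⟩⟩
  · obtain ⟨a, ha⟩ := h A hA hd
    exact ⟨a, lub A a ha⟩
  · exact fun a b hab haU => specializes_iff_forall_open.1 hab U hU haU
  · intro A hA hd a ha haU
    obtain ⟨c, hc⟩ := h A hA hd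
    -- The given least upper bound lies below the topological supremum, so open sets around it also
    -- contain `c`.
    have hac : c ⤳ a := ha.2 (lub A c hc).1
    exact (hc U hU).1 (specializes_iff_forall_open.1 hac U hU haU)

theorem IsDSpace.exists_isNhdsSup {Y : Type*} [TopologicalSpace Y] (hY : IsDSpace Y) {A : Set Y}
    (hA : A.Nonempty) (hd : DirectedOn (fun a b => b ⤳ a) A) : ∃ a, IsNhdsSup A a := by
  let _ := specializationPreorder Y
  obtain ⟨a, ha⟩ := hY.exists_isLUB A hA hd
  refine ⟨a, fun V hV => ⟨fun haV => ?_, fun ⟨b, hb, hbV⟩ => ?_⟩⟩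
  · exact (hY.scott_open_of_isOpen V hV).2 hA hd ha haV
  · exact specializes_iff_forall_open.1 (ha.1 hb) V hV hbV

namespace SubprobVal

variable {X : Type*} [TopologicalSpace X]

theorem isOpen_setOf_lt (U : Opens X) (r : unitInterval) :
    IsOpen {ν : SubprobVal X | r < ν U} :=
  isOpen_generateFrom_of_mem ⟨U, r, rfl⟩

theorem mem_of_le_of_mem_isOpen {O : Set (SubprobVal X)} (hO : IsOpen O) {μ ν : SubprobVal X}
    (h : μ ≤ ν) (hμ : μ ∈ O) : ν ∈ O := by
  induction hO with
  | basic s hs =>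
    obtain ⟨U, r, rfl⟩ := hs
    exact lt_of_lt_of_le hμ (h U)
  | univ => trivial
  | inter s t _ _ hs ht => exact ⟨hs hμ.1, ht hμ.2⟩
  | sUnion S _ hS =>
    obtain ⟨s, hs, hμs⟩ := hμ
    exact ⟨s, hs, hS s hs hμs⟩

theorem specializes_iff_le {μ ν : SubprobVal X} : ν ⤳ μ ↔ μ ≤ ν := by
  rw [specializes_iff_forall_open]
  refine ⟨fun h U => le_of_not_gt fun hlt => ?_, fun h O hO hμ => mem_of_le_of_mem_isOpen hO h hμ⟩
  exact lt_irrefl (ν U) (h {ξ | ν U < ξ U} (isOpen_setOf_lt U (ν U)) hlt)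

instance : T0Space (SubprobVal X) where
  t0 _ _ h := le_antisymm (specializes_iff_le.1 h.specializes')
    (specializes_iff_le.1 h.specializes)

/-- The pointwise supremum of a non-empty directed set of valuations. -/
noncomputable def directedSup (A : Set (SubprobVal X)) (hA : A.Nonempty)
    (hd : DirectedOn (· ≤ ·) A) : SubprobVal X where
  toFun U := ⨆ ν : A, ν.1 U
  scottContinuous' := by
    intro D hD hDd U hU
    refine ⟨?_, fun b hb => iSup_le fun ν => ?_⟩
    · rintro _ ⟨V, hV, rfl⟩
      exact iSup_mono fun ν => ν.1.scottContinuous'.monotone (hU.1 hV)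
    · refine (ν.1.scottContinuous' hD hDd hU).2 ?_
      rintro _ ⟨V, hV, rfl⟩
      exact (le_iSup (fun ν : A => ν.1 V) ν).trans (hb ⟨V, hV, rfl⟩)
  strict' := le_antisymm (iSup_le fun ν => ν.1.strict'.le) unitInterval.nonneg'
  modular' U V := by
    have := hA.to_subtype
    have : IsDirectedOrder A := directedOn_iff_isDirectedOrder.1 hd
    -- A monotone net in `[0, 1]` converges to its supremum, so modularity passes to the limit.
    have key : ∀ W : Opens X, Filter.Tendsto (fun ν : A => (ν.1 W : ℝ)) Filter.atTop
        (nhds ((⨆ ν : A, ν.1 W : unitInterval) : ℝ)) := fun W =>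
      (continuous_subtype_val.tendsto _).comp
        (tendsto_atTop_iSup fun μ ν (h : μ.1 ≤ ν.1) => h W)
    exact tendsto_nhds_unique ((key U).add (key V))
      (((key (U ⊔ V)).add (key (U ⊓ V))).congr fun ν => (ν.1.modular' U V).symm)

variable {A : Set (SubprobVal X)} {hA : A.Nonempty} {hd : DirectedOn (· ≤ ·) A}

theorem isLUB_directedSup : IsLUB A (directedSup A hA hd) :=
  ⟨fun ν hν U => le_iSup (fun ν : A => ν.1 U) ⟨ν, hν⟩, fun _ hb U => iSup_le fun ν => hb ν.2 U⟩

/-- The strict threshold in `[U > r]` is already passed by some member; directedness then handles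
finite intersections. -/
theorem isNhdsSup_directedSup : IsNhdsSup A (directedSup A hA hd) := by
  intro O hO
  refine ⟨fun h => ?_,
    fun ⟨ν, hν, hνO⟩ => mem_of_le_of_mem_isOpen hO (isLUB_directedSup.1 hν) hνO⟩
  induction hO with
  | basic s hs =>
    obtain ⟨U, r, rfl⟩ := hs
    obtain ⟨ν, hν⟩ := lt_iSup_iff.1 (show r < ⨆ ν : A, ν.1 U from h)
    exact ⟨ν.1, ν.2, hν⟩
  | univ => exact hA.imp fun ν hν => ⟨hν, trivial⟩
  | inter s t hs ht ihs iht =>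
    obtain ⟨μ, hμ, hμs⟩ := ihs h.1
    obtain ⟨ν, hν, hνt⟩ := iht h.2
    obtain ⟨ξ, hξ, hμξ, hνξ⟩ := hd μ hμ ν hν
    exact ⟨ξ, hξ, mem_of_le_of_mem_isOpen hs hμξ hμs, mem_of_le_of_mem_isOpen ht hνξ hνt⟩
  | sUnion S _ hS =>
    obtain ⟨s, hs, h⟩ := h
    obtain ⟨ν, hν, hνs⟩ := hS s hs h
    exact ⟨ν, hν, s, hs, hνs⟩

theorem isNhdsSup_of_isLUB (hA : A.Nonempty) (hd : DirectedOn (· ≤ ·) A) {a : SubprobVal X}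
    (ha : IsLUB A a) : IsNhdsSup A a :=
  ha.unique (isLUB_directedSup (hA := hA) (hd := hd)) ▸ isNhdsSup_directedSup

theorem dirSupClosed_minimalVal : DirSupClosed (minimalVal X) :=
  fun _ hAM hA hd _ ha => Set.mem_sInter.2 fun _ hB => hB.1 (fun _ h => hAM h _ hB) hA hd ha

theorem isDSpace_minimalVal : IsDSpace (minimalVal X) := by
  refine isDSpace_of_exists_isNhdsSup fun A hA hd => ?_
  have hA' : (Subtype.val '' A).Nonempty := hA.image _
  have hd' : DirectedOn (· ≤ ·) (Subtype.val '' A) := by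
    rintro _ ⟨μ, hμ, rfl⟩ _ ⟨ν, hν, rfl⟩
    obtain ⟨ξ, hξ, h₁, h₂⟩ := hd μ hμ ν hν
    exact ⟨ξ, ⟨ξ, hξ, rfl⟩, specializes_iff_le.1 ((subtype_specializes_iff _ _).1 h₁),
      specializes_iff_le.1 ((subtype_specializes_iff _ _).1 h₂)⟩
  refine ⟨⟨directedSup _ hA' hd', dirSupClosed_minimalVal (by simp) hA' hd' isLUB_directedSup⟩,
    fun V hV => ?_⟩
  obtain ⟨O, hO, rfl⟩ := isOpen_induced_iff.1 hV
  exact (isNhdsSup_directedSup (hA := hA') (hd := hd') O hO).trans Set.exists_mem_image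

/-- Induction principle for `minimalVal X`: a property that holds for the simple valuations and
passes to directed suprema holds throughout. -/
theorem minimalVal_induction {P : SubprobVal X → Prop} (hs : ∀ ν ∈ simple X, P ν)
    (hsup : ∀ (A : Set (SubprobVal X)) (a : SubprobVal X), A.Nonempty → DirectedOn (· ≤ ·) A →
      IsNhdsSup A a → (∀ ν ∈ A, P ν) → P a) {ν : SubprobVal X} (hν : ν ∈ minimalVal X) : P ν :=
  hν {ν | P ν} ⟨fun A hAP hA hd a ha => hsup A a hA hd (isNhdsSup_of_isLUB hA hd ha) hAP, hs⟩

theorem mem_iff_of_inter_simple {O O' : Set (SubprobVal X)} (hO : IsOpen O) (hO' : IsOpen O')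
    (h : ∀ ν ∈ simple X, ν ∈ O ↔ ν ∈ O') {ν : SubprobVal X} (hν : ν ∈ minimalVal X) :
    ν ∈ O ↔ ν ∈ O' := by
  refine minimalVal_induction (P := fun ν => ν ∈ O ↔ ν ∈ O') h (fun A a _ _ ha hP => ?_) hν
  rw [ha O hO, ha O' hO']
  exact exists_congr fun ν => and_congr_right (hP ν)

theorem eq_of_comp_inclusion_eq {Y : Type*} [TopologicalSpace Y] [T0Space Y]
    {g g' : minimalVal X → Y} (hg : Continuous g) (hg' : Continuous g')
    (h : g ∘ Set.inclusion (simple_subset_minimalVal X) =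
      g' ∘ Set.inclusion (simple_subset_minimalVal X)) : g = g' := by
  funext ν
  refine (inseparable_iff_forall_isOpen.2 fun V hV => ?_).eq
  obtain ⟨O, hO, hgO⟩ := isOpen_induced_iff.1 (hV.preimage hg)
  obtain ⟨O', hO', hgO'⟩ := isOpen_induced_iff.1 (hV.preimage hg')
  have e : ∀ μ : minimalVal X, μ.1 ∈ O ↔ g μ ∈ V := fun μ => Set.ext_iff.1 hgO μ
  have e' : ∀ μ : minimalVal X, μ.1 ∈ O' ↔ g' μ ∈ V := fun μ => Set.ext_iff.1 hgO' μ
  rw [← e, ← e']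
  refine mem_iff_of_inter_simple hO hO' (fun μ hμ => ?_) ν.2
  have hμg : g ⟨μ, _⟩ = g' ⟨μ, _⟩ := congrFun h ⟨μ, hμ⟩
  exact (e ⟨μ, _⟩).trans (hμg ▸ (e' ⟨μ, simple_subset_minimalVal X hμ⟩).symm)

theorem exists_continuous_extension {Y : Type*} [TopologicalSpace Y] (hY : IsDSpace Y)
    {f : simple X → Y} (hf : Continuous f) :
    ∃ g : minimalVal X → Y, Continuous g ∧
      f = g ∘ Set.inclusion (simple_subset_minimalVal X) := by
  have := hY.t0
  have hex : ∀ V : Opens Y, ∃ O : Set (SubprobVal X), IsOpen O ∧ Subtype.val ⁻¹' O = f ⁻¹' V :=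
    fun V => isOpen_induced_iff.1 (V.isOpen.preimage hf)
  -- No compatibility of `W` with inclusions or unions is required: the induction below makes `{V |
  -- ν ∈ W V}` the neighbourhood filter trace of a point.
  choose W hW hWf using hex
  have hWmem : ∀ (V : Opens Y) (ν : simple X), ν.1 ∈ W V ↔ f ν ∈ V :=
    fun V ν => Set.ext_iff.1 (hWf V) ν
  have hval : ∀ ν : minimalVal X, ∃ y : Y, ∀ V : Opens Y, y ∈ V ↔ ν.1 ∈ W V := by
    rintro ⟨ν, hν⟩
    refine minimalVal_induction (P := fun ν => ∃ y : Y, ∀ V : Opens Y, y ∈ V ↔ ν ∈ W V)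
      (fun ν hν => ⟨f ⟨ν, hν⟩, fun V => (hWmem V ⟨ν, hν⟩).symm⟩) (fun A a hA hd ha hP => ?_) hν
    have : Nonempty Y := hA.elim fun ν hν => (hP ν hν).nonempty
    choose! y hy using hP
    have hd' : DirectedOn (fun a b => b ⤳ a) (y '' A) := by
      rintro _ ⟨μ, hμ, rfl⟩ _ ⟨ν, hν, rfl⟩
      obtain ⟨ξ, hξ, h₁, h₂⟩ := hd μ hμ ν hν
      -- Each `W V` is an upper set, so `y` is monotone and its image is directed.
      have mono : ∀ μ ∈ A, μ ≤ ξ → y ξ ⤳ y μ := fun μ hμ hle =>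
        specializes_iff_forall_open.2 fun V hV hyV => (hy ξ hξ ⟨V, hV⟩).2
          (mem_of_le_of_mem_isOpen (hW _) hle ((hy μ hμ ⟨V, hV⟩).1 hyV))
      exact ⟨y ξ, ⟨ξ, hξ, rfl⟩, mono μ hμ h₁, mono ν hν h₂⟩
    obtain ⟨z, hz⟩ := hY.exists_isNhdsSup (hA.image y) hd'
    refine ⟨z, fun V => (hz V V.isOpen).trans ?_⟩
    rw [ha (W V) (hW V), Set.exists_mem_image]
    exact exists_congr fun μ => and_congr_right fun hμ => hy μ hμ V
  choose g hg using hval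
  -- The preimage of `V` under `g` is the trace of `W V`.
  refine ⟨g, continuous_def.2 fun V hV => isOpen_induced_iff.2 ⟨W ⟨V, hV⟩, hW _, ?_⟩, ?_⟩
  · ext ν
    exact (hg ν ⟨V, hV⟩).symm
  · funext ν
    refine (inseparable_iff_forall_isOpen.2 fun V hV => ?_).eq
    exact (hWmem ⟨V, hV⟩ ν).symm.trans (hg (Set.inclusion _ ν) ⟨V, hV⟩).symm

end SubprobVal

theorem mainTheorem11 (X : Type*) [TopologicalSpace X] :
    IsDSpace (SubprobVal.minimalVal X) ∧
    Continuous (Set.inclusion (SubprobVal.simple_subset_minimalVal X)) ∧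
    ∀ (Y : Type*) [TopologicalSpace Y], IsDSpace Y →
      ∀ f : SubprobVal.simple X → Y, Continuous f →
        ∃! f' : SubprobVal.minimalVal X → Y, Continuous f' ∧
          f = f' ∘ Set.inclusion (SubprobVal.simple_subset_minimalVal X) := by
  refine ⟨SubprobVal.isDSpace_minimalVal, continuous_inclusion _, fun Y _ hY f hf => ?_⟩
  have := hY.t0
  obtain ⟨g, hg, hfg⟩ := SubprobVal.exists_continuous_extension hY hf
  exact ⟨g, ⟨hg, hfg⟩, fun g' hg' =>
    SubprobVal.eq_of_comp_inclusion_eq hg'.1 hg (hg'.2.symm.trans hfg)⟩
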